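/- Let $(X,d)$ be a proper metric space with a Borel measure $\mu$ that is positive on every non-empty open set and finite on every ball. Let $1\le Q<p$. Assume that (a) $(X,d,\mu)$ is locally $Q$-homogeneous: for every compact $K\subseteq X$ there are $R>0$ and $C\ge 1$ such that $\mu(B(x,r_2))/r_2^{Q}\le C\,\mu(B(x,r_1))/r_1^{Q}$ for all $x\in K$ and $0<r_1\le r_2<R$; (b) $(X,d,\mu)$ supports a local $Q$-Poincaré inequality: for every compact $K\subseteq X$ there are $C\ge1$, $\sigma\ge 1$ and $R>0$ such that, for every continuous $u\colon X\to\mathbb R$, every upper gradient $g$ of $u$, and every ball $B=B(x,r)$ with $x\in K$ and $0<r<R$, $$\frac1{\mu(B)}\int_B|u-u_B|\,d\mu\le C\,\operatorname{diam}(B)\left(\frac1{\mu(\sigma B)}\int_{\sigma B}g^Q\,d\mu\right)^{1/Q},$$ where $u_B=\frac1{\mu(B)}\int_B u\,d\mu$ and $\sigma B=B(x,\sigma r)$. Here an upper gradient of a continuous map $h$ from $X$ to a metric space $(Z,d_Z)$ is a Borel function $g\colon X\to[0,\infty]$ with $d_Z(h(\gamma(0)),h(\gamma(1)))\le\int_\gamma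 g\,ds$ for every rectifiable curve $\gamma\colon[0,1]\to X$. Let $Y$ be any metric space and let $f\colon X\to Y$ be a continuous map that has an upper gradient in $L^p_{\mathrm{loc}}(X)$. Let $0<t<Q$ and let $E\subseteq X$ be a set with $\mu(E)=0$ that is Ahlfors $t$-regular, i.e. there is $C\ge1$ such that $r^t/C\le\mathcal H^t(B(x,r)\cap E)\le C r^t$ for all $x\in E$ and all $0<r<\infty$ with $r\le 2\operatorname{diam}E$. Then $$\mathcal H^{\frac{pt}{p-Q+t}}(f(E))=0.$$ -/

import Mathlib

open MeasureTheory Set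
open scoped ENNReal NNReal

namespace SobolevDistortion

noncomputable section

/-- A rectifiable curve `γ : [0,1] → X`: continuous on `[0,1]` and of finite length.
(The values of `γ` outside `[0,1]` are irrelevant.) -/
def IsRectifiableCurve {X : Type*} [MetricSpace X] (γ : ℝ → X) : Prop :=
  ContinuousOn γ (Icc 0 1) ∧ BoundedVariationOn γ (Icc 0 1)

/-- The length of a curve `γ : [0,1] → X`. -/
def curveLength {X : Type*} [MetricSpace X] (γ : ℝ → X) : ℝ :=
  (eVariationOn γ (Icc 0 1)).toReal

/-- The line integral `∫_γ g ds` of a Borel function `g : X → [0,∞]` along a rectifiable curve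
`γ : [0,1] → X`: the integral over `[0, length γ]` of `g` composed with the arc length
parametrization of `γ`. -/
def lineIntegral {X : Type*} [MetricSpace X] (γ : ℝ → X) (g : X → ℝ≥0∞) : ℝ≥0∞ :=
  ∫⁻ s in Icc 0 (curveLength γ), g (naturalParameterization γ (Icc 0 1) 0 s)

/-- A Borel function `g : X → [0,∞]` is an upper gradient of `f : X → Y` if
`d(f(γ(0)), f(γ(1))) ≤ ∫_γ g ds` for every rectifiable curve `γ : [0,1] → X`. -/
def IsUpperGradient {X Y : Type*} [MetricSpace X] [MeasurableSpace X] [MetricSpace Y]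
    (f : X → Y) (g : X → ℝ≥0∞) : Prop :=
  Measurable g ∧
    ∀ γ : ℝ → X, IsRectifiableCurve γ → edist (f (γ 0)) (f (γ 1)) ≤ lineIntegral γ g

/-- The `p`-th power of `g : X → [0,∞]` is integrable over every compact set. -/
def LpLoc {X : Type*} [MetricSpace X] [MeasurableSpace X] (μ : Measure X) (p : ℝ)
    (g : X → ℝ≥0∞) : Prop :=
  ∀ K : Set X, IsCompact K → ∫⁻ x in K, g x ^ p ∂μ < ∞

/-- Local `Q`-homogeneity of `(X, d, μ)`: for every compact `K` there are `R > 0` and `C ≥ 1` with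
`μ(B(x,r₂)) / r₂^Q ≤ C μ(B(x,r₁)) / r₁^Q` for all `x ∈ K` and `0 < r₁ ≤ r₂ < R`. -/
def IsLocallyHomogeneous {X : Type*} [MetricSpace X] [MeasurableSpace X] (μ : Measure X)
    (Q : ℝ) : Prop :=
  ∀ K : Set X, IsCompact K → ∃ R : ℝ, 0 < R ∧ ∃ C : ℝ≥0, 1 ≤ C ∧
    ∀ x ∈ K, ∀ r₁ r₂ : ℝ, 0 < r₁ → r₁ ≤ r₂ → r₂ < R →
      μ (Metric.ball x r₂) / ENNReal.ofReal (r₂ ^ Q) ≤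
        C * (μ (Metric.ball x r₁) / ENNReal.ofReal (r₁ ^ Q))

/-- The local `q`-Poincaré inequality on `(X, d, μ)`. -/
def SupportsLocalPoincare {X : Type*} [MetricSpace X] [MeasurableSpace X] (μ : Measure X)
    (q : ℝ) : Prop :=
  ∀ K : Set X, IsCompact K → ∃ C : ℝ≥0, 1 ≤ C ∧ ∃ σ : ℝ, 1 ≤ σ ∧ ∃ R : ℝ, 0 < R ∧
    ∀ (f : X → ℝ) (g : X → ℝ≥0∞), Continuous f → IsUpperGradient f g →
      ∀ x ∈ K, ∀ r : ℝ, 0 < r → r < R →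
        ⨍⁻ y in Metric.ball x r, ‖f y - ⨍ z in Metric.ball x r, f z ∂μ‖ₑ ∂μ ≤
          C * Metric.ediam (Metric.ball x r) *
            (⨍⁻ y in Metric.ball x (σ * r), g y ^ q ∂μ) ^ (1 / q)

/-- `E ⊆ X` is Ahlfors `t`-regular: there is `C ≥ 1` such that
`r^t / C ≤ H^t(B(x,r) ∩ E) ≤ C r^t` for all `x ∈ E` and all real `0 < r ≤ 2 diam E`
(all `r > 0` when `E` is unbounded). -/
def IsAhlforsRegularSet {X : Type*} [MetricSpace X] [MeasurableSpace X] [BorelSpace X]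
    (t : ℝ) (E : Set X) : Prop :=
  ∃ C : ℝ≥0, 1 ≤ C ∧ ∀ x ∈ E, ∀ r : ℝ, 0 < r → ENNReal.ofReal r ≤ 2 * Metric.ediam E →
    ENNReal.ofReal (r ^ t) / C ≤ Measure.hausdorffMeasure t (Metric.ball x r ∩ E) ∧
      Measure.hausdorffMeasure t (Metric.ball x r ∩ E) ≤ C * ENNReal.ofReal (r ^ t)

end

end SobolevDistortion

/-! Since `p > Q`, the Poincaré inequality gives a Morrey estimate (`exists_morrey_estimate`): diam
f(B(x,r)) ≲ r^(1-Q/p) ν(B(x,lr))^(1/p), where dν = g^p dμ. With θ = t/(p-Q+t), the exponent α =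
pt/(p-Q+t) is the one for which the α-th power of the right side is (r^t)^(1-θ) ν(B(x,lr))^θ. Hölder
therefore bounds Σ (diam f(Bᵢ))^α by (Σ rᵢ^t)^(1-θ) (Σ ν(lBᵢ))^θ. If the Bᵢ are centred in E and
have disjoint cores, Ahlfors regularity bounds the first sum by H^t of a bounded piece of E. If the
lBᵢ stay in an open U around that piece with bounded overlap, the second sum is ≲ ν(U), which can be
made arbitrarily small because ν ≪ μ and μ(E) = 0.

Bounded overlap is the reason for a Whitney-type cover (`exists_whitney_covering`): dilated balls
with a common point have comparable radii, so H^t on E limits the number of their disjoint cores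
(`card_le_of_regular`). -/

namespace SobolevDistortion

open Filter Topology Metric

variable {X Y : Type*} [MetricSpace X] [MetricSpace Y]

/-! ### Morrey's estimate from homogeneity and the Poincaré inequality. -/

section

variable [MeasurableSpace X]

/-- Upper gradients are inherited by the distance functions to a point of the target. -/
lemma IsUpperGradient.dist_const {f : X → Y} {g : X → ℝ≥0∞} (h : IsUpperGradient f g) (y : Y) :
    IsUpperGradient (fun x => dist (f x) y) g := by
  refine ⟨h.1, fun γ hγ => le_trans ?_ (h.2 γ hγ)⟩
  rw [edist_dist, edist_dist]
  exact ENNReal.ofReal_le_ofReal (dist_dist_dist_le_left _ _ _)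

/-- Local homogeneity gives a lower mass bound and doubling on compact sets. -/
lemma IsLocallyHomogeneous.exists_lower_mass_bound [BorelSpace X] {μ : Measure X}
    [IsLocallyFiniteMeasure μ] [μ.IsOpenPosMeasure] {Q : ℝ} (hQ : 0 < Q)
    (h : IsLocallyHomogeneous μ Q) {K : Set X} (hK : IsCompact K) :
    ∃ R : ℝ, 0 < R ∧ ∃ m : ℝ≥0∞, m ≠ 0 ∧ m ≠ ∞ ∧ ∃ D : ℝ≥0∞, D ≠ ∞ ∧ ∀ x ∈ K, ∀ r : ℝ, 0 < r →
      r < R → m * ENNReal.ofReal r ^ Q ≤ μ (ball x r) ∧ μ (ball x (3 * r)) ≤ D * μ (ball x r) := by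
  obtain ⟨R, hR, C, hC, H⟩ := h K hK
  have hC0 : (C : ℝ≥0∞) ≠ 0 := by
    have : C ≠ 0 := (zero_lt_one.trans_le hC).ne'
    exact_mod_cast this
  obtain ⟨m, hm0, hmT, hm⟩ : ∃ m : ℝ≥0∞, m ≠ 0 ∧ m ≠ ∞ ∧ ∀ x ∈ K, m ≤ μ (ball x (R / 2)) := by
    obtain ⟨T, hTK, hTf, hT⟩ := hK.finite_cover_balls (e := R / 4) (by positivity)
    -- Each B(x, R/2) contains one of the finitely many balls B(z, R/4). The cap by 1 keeps `m`
    -- finite, even for empty `K`.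
    refine ⟨(⨅ z ∈ T, μ (ball z (R / 4))) ⊓ 1, ?_, ?_, fun x hx => ?_⟩
    · refine (lt_inf_iff.2 ⟨?_, zero_lt_one⟩).ne'
      rcases T.eq_empty_or_nonempty with rfl | hne
      · simp
      · obtain ⟨z, hz, hzm⟩ := T.exists_min_image (fun z => μ (ball z (R / 4))) hTf hne
        exact lt_of_lt_of_le (measure_ball_pos μ z (by positivity)) (le_iInf₂ hzm)
    · exact (lt_of_le_of_lt inf_le_right ENNReal.one_lt_top).ne
    · obtain ⟨z, hz, hxz⟩ := mem_iUnion₂.1 (hT hx)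
      refine inf_le_left.trans ((iInf₂_le z hz).trans (measure_mono fun w hw => ?_))
      rw [mem_ball] at *
      have := dist_triangle_right w x z
      linarith
  have key : ∀ x ∈ K, ∀ r₁ r₂ : ℝ, 0 < r₁ → r₁ ≤ r₂ → r₂ < R →
      μ (ball x r₂) * ENNReal.ofReal r₁ ^ Q ≤ C * μ (ball x r₁) * ENNReal.ofReal r₂ ^ Q := by
    intro x hx r₁ r₂ h₁ h₁₂ h₂
    have := H x hx r₁ r₂ h₁ h₁₂ h₂
    have h₂' : 0 < r₂ := h₁.trans_le h₁₂
    rw [← ENNReal.ofReal_rpow_of_pos h₁, ← ENNReal.ofReal_rpow_of_pos h₂', ← mul_div_assoc] at this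
    have p₁ : ENNReal.ofReal r₁ ^ Q ≠ 0 := (ENNReal.rpow_pos (by simpa) (by simp)).ne'
    have p₂ : ENNReal.ofReal r₂ ^ Q ≠ 0 := (ENNReal.rpow_pos (by simpa) (by simp)).ne'
    have q₁ : ENNReal.ofReal r₁ ^ Q ≠ ∞ := ENNReal.rpow_ne_top_of_nonneg hQ.le (by simp)
    have q₂ : ENNReal.ofReal r₂ ^ Q ≠ ∞ := ENNReal.rpow_ne_top_of_nonneg hQ.le (by simp)
    rw [ENNReal.div_le_iff p₂ q₂] at this
    calc _ ≤ (C * μ (ball x r₁) / ENNReal.ofReal r₁ ^ Q * ENNReal.ofReal r₂ ^ Q)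
          * ENNReal.ofReal r₁ ^ Q := by gcongr
      _ = (C * μ (ball x r₁) / ENNReal.ofReal r₁ ^ Q * ENNReal.ofReal r₁ ^ Q)
          * ENNReal.ofReal r₂ ^ Q := by ring
      _ = _ := by rw [ENNReal.div_mul_cancel p₁ q₁]
  have hRQ0 : ENNReal.ofReal (R / 2) ^ Q ≠ 0 := (ENNReal.rpow_pos (by simpa) (by simp)).ne'
  have hRQ : ENNReal.ofReal (R / 2) ^ Q ≠ ∞ := ENNReal.rpow_ne_top_of_nonneg hQ.le (by simp)
  -- The mass bound compares the radii r and R/2, the doubling bound r and 3r; r < R/3 makes both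
  -- comparisons admissible.
  refine ⟨R / 3, by positivity, m / (C * ENNReal.ofReal (R / 2) ^ Q), ?_, ?_,
    C * ENNReal.ofReal 3 ^ Q, ?_, fun x hx r hr hrR => ⟨?_, ?_⟩⟩
  · exact ENNReal.div_ne_zero.2 ⟨hm0, ENNReal.mul_ne_top (by simp) hRQ⟩
  · exact ENNReal.div_ne_top hmT (mul_ne_zero hC0 hRQ0)
  · exact ENNReal.mul_ne_top (by simp) (ENNReal.rpow_ne_top_of_nonneg hQ.le (by simp))
  · have := key x hx r (R / 2) hr (by linarith) (by linarith)
    rw [mul_comm, ← mul_div_assoc]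
    refine ENNReal.div_le_of_le_mul ?_
    calc _ = m * ENNReal.ofReal r ^ Q := by ring
      _ ≤ μ (ball x (R / 2)) * ENNReal.ofReal r ^ Q := by gcongr; exact hm x hx
      _ ≤ _ := this
      _ = _ := by ring
  · have := key x hx r (3 * r) hr (by linarith) (by linarith)
    rw [ENNReal.ofReal_mul (by norm_num), ENNReal.mul_rpow_of_nonneg _ _ hQ.le] at this
    have p₁ : ENNReal.ofReal r ^ Q ≠ 0 := (ENNReal.rpow_pos (by simpa) (by simp)).ne'
    have q₁ : ENNReal.ofReal r ^ Q ≠ ∞ := ENNReal.rpow_ne_top_of_nonneg hQ.le (by simp)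
    rw [← ENNReal.mul_le_mul_iff_left p₁ q₁]
    calc _ ≤ _ := this
      _ = _ := by ring

/-- Averages over comparable nested sets differ by at most the mean oscillation. -/
lemma edist_setAverage_le {Ω : Type*} [MeasurableSpace Ω] {μ : Measure Ω} {A B : Set Ω}
    (hAB : A ⊆ B) (hA0 : μ A ≠ 0) (hB : μ B ≠ ∞) {D : ℝ≥0∞} (hD : μ B ≤ D * μ A) {u : Ω → ℝ} (hu : IntegrableOn u B μ) :
    edist (⨍ z in B, u z ∂μ) (⨍ z in A, u z ∂μ) ≤
      D * ⨍⁻ y in B, ‖u y - ⨍ z in B, u z ∂μ‖ₑ ∂μ := by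
  set b := ⨍ z in B, u z ∂μ
  have hA : μ A ≠ ∞ := ((measure_mono hAB).trans_lt hB.lt_top).ne
  have hB0 : μ B ≠ 0 := fun h => hA0 (measure_mono_null hAB h)
  have huA := hu.mono_set hAB
  have hav : (⨍ z in A, u z ∂μ) - b = ⨍ z in A, (u z - b) ∂μ := by
    have : IsFiniteMeasure (μ.restrict A) := ⟨by simpa using hA.lt_top⟩
    have hr : μ.real A ≠ 0 := (ENNReal.toReal_pos hA0 hA).ne'
    rw [setAverage_eq, setAverage_eq, integral_sub huA (integrable_const _), setIntegral_const]
    simp only [smul_eq_mul, mul_sub, inv_mul_cancel_left₀ hr]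
  rw [edist_comm, edist_eq_enorm_sub, hav, setLAverage_eq]
  calc ‖⨍ z in A, (u z - b) ∂μ‖ₑ ≤ (∫⁻ z in A, ‖u z - b‖ₑ ∂μ) / μ A := by
        rw [← setLAverage_eq]; exact enorm_integral_le_lintegral_enorm _
    _ ≤ (∫⁻ z in B, ‖u z - b‖ₑ ∂μ) / μ A := by gcongr
    _ ≤ (∫⁻ z in B, ‖u z - b‖ₑ ∂μ) * (D / μ B) := by
        rw [div_eq_mul_inv]; gcongr
        rw [ENNReal.le_div_iff_mul_le (.inl hB0) (.inl hB), mul_comm, ← div_eq_mul_inv]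
        exact ENNReal.div_le_of_le_mul hD
    _ = _ := by rw [div_eq_mul_inv, div_eq_mul_inv]; ring

/-- Jensen's inequality for averages. -/
lemma setLAverage_rpow_le {Ω : Type*} [MeasurableSpace Ω] {μ : Measure Ω} {B : Set Ω}
    (hB0 : μ B ≠ 0) (hB : μ B ≠ ∞) {Q p : ℝ} (hQ : 0 < Q) (hp : Q ≤ p) {g : Ω → ℝ≥0∞}
    (hg : Measurable g) :
    (⨍⁻ y in B, g y ^ Q ∂μ) ^ (1 / Q) ≤ (⨍⁻ y in B, g y ^ p ∂μ) ^ (1 / p) := by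
  have : IsProbabilityMeasure ((μ.restrict B univ)⁻¹ • μ.restrict B) :=
    ⟨by simp [ENNReal.inv_mul_cancel hB0 hB]⟩
  have := eLpNorm'_le_eLpNorm'_of_exponent_le (f := g) hQ hp
    ((μ.restrict B univ)⁻¹ • μ.restrict B) hg.aestronglyMeasurable
  simpa [eLpNorm', laverage] using this

/-- The averages over shrinking balls of a continuous function converge to the value. -/
lemma tendsto_setAverage_ball [BorelSpace X] [ProperSpace X] {μ : Measure X}
    [IsLocallyFiniteMeasure μ] [μ.IsOpenPosMeasure] {u : X → ℝ} (hu : Continuous u) (y : X)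
    {ρ : ℕ → ℝ} (hρ : ∀ n, 0 < ρ n) (hlim : Tendsto ρ atTop (𝓝 0)) :
    Tendsto (fun n => ⨍ z in ball y (ρ n), u z ∂μ) atTop (𝓝 (u y)) := by
  rw [Metric.tendsto_nhds]
  intro ε hε
  obtain ⟨δ, hδ, H⟩ := Metric.continuousAt_iff.1 hu.continuousAt (ε / 2) (by positivity)
  filter_upwards [hlim.eventually (gt_mem_nhds hδ)] with n hn
  have hint : IntegrableOn u (ball y (ρ n)) μ :=
    (hu.continuousOn.integrableOn_compact (isCompact_closedBall y (ρ n))).mono_set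
      ball_subset_closedBall
  have hmem := (convex_closedBall (u y) (ε / 2)).set_average_mem isClosed_closedBall
    (measure_ball_pos μ y (hρ n)).ne' measure_ball_lt_top.ne
    (by
      filter_upwards [ae_restrict_mem measurableSet_ball] with z hz
      exact (H ((mem_ball.1 hz).trans hn)).le) hint
  exact (mem_closedBall.1 hmem).trans_lt (by linarith)

/-- The Poincaré inequality combined with the lower mass bound. -/
lemma exists_poincare_lower_mass [BorelSpace X] [ProperSpace X] {μ : Measure X}
    [IsLocallyFiniteMeasure μ] [μ.IsOpenPosMeasure] {Q p : ℝ} (hQ : 0 < Q) (hp : Q < p)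
    (hhom : IsLocallyHomogeneous μ Q) (hpoin : SupportsLocalPoincare μ Q) {K : Set X}
    (hK : IsCompact K) :
    ∃ R : ℝ, 0 < R ∧ ∃ A : ℝ≥0∞, A ≠ ∞ ∧ ∃ D : ℝ≥0∞, D ≠ ∞ ∧ ∃ σ : ℝ, 1 ≤ σ ∧
      (∀ x ∈ K, ∀ r : ℝ, 0 < r → r < R → μ (ball x (3 * r)) ≤ D * μ (ball x r)) ∧
      ∀ (u : X → ℝ) (g : X → ℝ≥0∞), Continuous u → IsUpperGradient u g →
      ∀ x ∈ K, ∀ r : ℝ, 0 < r → r < R → ∀ B : Set X, ball x (σ * r) ⊆ B →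
        ⨍⁻ y in ball x r, ‖u y - ⨍ z in ball x r, u z ∂μ‖ₑ ∂μ ≤
          A * ENNReal.ofReal r ^ (1 - Q / p) * (∫⁻ y in B, g y ^ p ∂μ) ^ (1 / p) := by
  obtain ⟨R₁, hR₁, m, hm0, hmT, D, hD, H₁⟩ := hhom.exists_lower_mass_bound hQ hK
  obtain ⟨C, hC, σ, hσ, R₂, hR₂, H₂⟩ := hpoin K hK
  have hp0 : 0 < p := hQ.trans hp
  refine ⟨min R₁ R₂, lt_min hR₁ hR₂, C * 2 * (m ^ (1 / p))⁻¹, ?_, D, hD, σ, hσ,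
    fun x hx r hr hrR => (H₁ x hx r hr (hrR.trans_le (min_le_left _ _))).2, ?_⟩
  · refine ENNReal.mul_ne_top (ENNReal.mul_ne_top (by simp) (by simp)) ?_
    exact ENNReal.inv_ne_top.2 (ENNReal.rpow_pos (pos_iff_ne_zero.2 hm0) hmT).ne'
  intro u g hu hg x hx r hr hrR B hB
  have hσr : 0 < σ * r := by positivity
  have hmass := (H₁ x hx r hr (hrR.trans_le (min_le_left _ _))).1
  have hr0 : ENNReal.ofReal r ≠ 0 := by simpa
  have hdiam : ediam (ball x r) ≤ 2 * ENNReal.ofReal r := by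
    rw [← Metric.eball_ofReal]; exact ediam_eball_le
  have hmr : (m * ENNReal.ofReal r ^ Q) ^ (1 / p)
      = m ^ (1 / p) * ENNReal.ofReal r ^ (Q / p) := by
    rw [ENNReal.mul_rpow_of_nonneg _ _ (by positivity), ← ENNReal.rpow_mul]
    congr 2; ring
  have hpow : ENNReal.ofReal r * (ENNReal.ofReal r ^ (Q / p))⁻¹
      = ENNReal.ofReal r ^ (1 - Q / p) := by
    rw [← div_eq_mul_inv, ENNReal.rpow_sub _ _ hr0 (by simp), ENNReal.rpow_one]
  have hm1 : m ^ (1 / p) ≠ 0 := (ENNReal.rpow_pos (pos_iff_ne_zero.2 hm0) hmT).ne'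
  have hm2 : m ^ (1 / p) ≠ ∞ := ENNReal.rpow_ne_top_of_nonneg (by positivity) hmT
  calc _ ≤ C * ediam (ball x r) * (⨍⁻ y in ball x (σ * r), g y ^ Q ∂μ) ^ (1 / Q) :=
        H₂ u g hu hg x hx r hr (hrR.trans_le (min_le_right _ _))
    _ ≤ C * (2 * ENNReal.ofReal r) * (⨍⁻ y in ball x (σ * r), g y ^ p ∂μ) ^ (1 / p) := by
        gcongr
        exact setLAverage_rpow_le (measure_ball_pos μ x hσr).ne' measure_ball_lt_top.ne hQ hp.le
          hg.1
    -- The mass bound is used at radius r and passed to σr by monotonicity, since σr may exceed the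
    -- scale where it holds.
    _ ≤ C * (2 * ENNReal.ofReal r) *
        ((∫⁻ y in B, g y ^ p ∂μ) / (m * ENNReal.ofReal r ^ Q)) ^ (1 / p) := by
        rw [setLAverage_eq]
        gcongr
        refine hmass.trans (measure_mono (ball_subset_ball ?_))
        nlinarith
    _ = C * 2 * (m ^ (1 / p))⁻¹ * (ENNReal.ofReal r * (ENNReal.ofReal r ^ (Q / p))⁻¹) *
        (∫⁻ y in B, g y ^ p ∂μ) ^ (1 / p) := by
        rw [ENNReal.div_rpow_of_nonneg _ _ (by positivity), hmr, div_eq_mul_inv,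
          ENNReal.mul_inv (.inl hm1) (.inl hm2)]
        ring
    _ = _ := by rw [hpow]

/-- Morrey's estimate: the oscillation of a continuous map on small balls is controlled by the
`L^p` norm of an upper gradient. -/
theorem exists_morrey_estimate [BorelSpace X] [ProperSpace X] {μ : Measure X}
    [IsLocallyFiniteMeasure μ] [μ.IsOpenPosMeasure] {Q p : ℝ} (hQ : 0 < Q) (hp : Q < p)
    (hhom : IsLocallyHomogeneous μ Q) (hpoin : SupportsLocalPoincare μ Q) {K : Set X}
    (hK : IsCompact K) {f : X → Y} {g : X → ℝ≥0∞} (hf : Continuous f)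
    (hg : IsUpperGradient f g) :
    ∃ R : ℝ, 0 < R ∧ ∃ A : ℝ≥0∞, A ≠ ∞ ∧ ∃ l : ℝ, 1 ≤ l ∧ ∀ x ∈ K, ∀ r : ℝ, 0 < r → r < R →
      ediam (f '' ball x r) ≤
        A * ENNReal.ofReal r ^ (1 - Q / p) * (∫⁻ y in ball x (l * r), g y ^ p ∂μ) ^ (1 / p) := by
  have hp0 : 0 < p := hQ.trans hp
  have hβ : 0 < 1 - Q / p := by rw [sub_pos, div_lt_one hp0]; exact hp
  -- The chains below use balls centred at points at distance less than 1 from `K`, hence the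
  -- thickening.
  obtain ⟨R, hR, A, hA, D, hD, σ, hσ, Hd, HP⟩ :=
    exists_poincare_lower_mass hQ hp hhom hpoin (hK.cthickening (r := 1))
  set β := 1 - Q / p
  set q : ℝ≥0∞ := ENNReal.ofReal (1 / 2) ^ β
  have hq : q < 1 := ENNReal.rpow_lt_one (by rw [ENNReal.ofReal_lt_one]; norm_num) hβ
  -- 1/(1 - q) sums the geometric series of the chain. The factor 4 comes from two triangle
  -- inequalities: through the common average, and through f(x).
  refine ⟨min (R / 3) 1, by positivity, 4 * (D * A * ENNReal.ofReal 2 ^ β / (1 - q)), ?_,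
    2 * σ, by linarith, ?_⟩
  · refine ENNReal.mul_ne_top (by simp) (ENNReal.div_ne_top (ENNReal.mul_ne_top
      (ENNReal.mul_ne_top hD hA) (ENNReal.rpow_ne_top_of_nonneg hβ.le (by simp))) ?_)
    exact (tsub_pos_of_lt hq).ne'
  intro x hx r hr hrR
  have hrR' : r < R / 3 := hrR.trans_le (min_le_left _ _)
  have hr1 : r < 1 := hrR.trans_le (min_le_right _ _)
  set I : ℝ≥0∞ := (∫⁻ y in ball x (2 * σ * r), g y ^ p ∂μ) ^ (1 / p)
  -- This reduces to a real-valued function; as u(x) = 0, its increments from x are exactly the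
  -- distances d(f(y), f(x)).
  set u : X → ℝ := fun y => dist (f y) (f x)
  have hu : Continuous u := hf.dist continuous_const
  have hug : IsUpperGradient u g := hg.dist_const _
  have hint : ∀ z s, IntegrableOn u (ball z s) μ := fun z s =>
    (hu.continuousOn.integrableOn_compact (isCompact_closedBall z s)).mono_set
      ball_subset_closedBall
  have main : ∀ y ∈ ball x r, edist (⨍ z in ball x (2 * r), u z ∂μ) (u y) ≤
      D * A * ENNReal.ofReal (2 * r) ^ β * I / (1 - q) := by
    intro y hy
    have hy' : dist y x < r := hy
    have hxK : x ∈ cthickening 1 K := self_subset_cthickening K hx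
    have hyK : y ∈ cthickening 1 K :=
      mem_cthickening_of_dist_le y x 1 K hx (hy'.le.trans hr1.le)
    set ρ : ℕ → ℝ := fun n => 2 * r * (1 / 2) ^ n
    have hρ : ∀ n, 0 < ρ n := fun n => by positivity
    have hρs : ∀ n, ρ n = 2 * ρ (n + 1) := fun n => by simp only [ρ]; ring
    have hρle : ∀ n, ρ (n + 1) ≤ r := fun n => by
      have : ((1 : ℝ) / 2) ^ n ≤ 1 := pow_le_one₀ (by norm_num) (by norm_num)
      simp only [ρ, pow_succ]
      nlinarith
    have hρR : ∀ n, 3 * ρ (n + 1) < R := fun n => by linarith [hρle n]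
    -- The chain starts at B(x, 2r), common to all y, and continues with B(y, r), B(y, r/2), ...;
    -- its averages lead from a fixed number to u(y).
    let c : ℕ → X := fun n => if n = 0 then x else y
    have hc0 : c 0 = x := rfl
    have hcs : ∀ n, c (n + 1) = y := fun n => rfl
    have hcK : ∀ n, c n ∈ cthickening 1 K := fun n => by
      rcases n with _ | n
      exacts [hxK, hyK]
    have hcd : ∀ n, dist y (c n) < ρ (n + 1) := fun n => by
      rcases n with _ | n
      · rw [hc0]; simp only [ρ]; linarith
      · rw [hcs, dist_self]; exact hρ _
    have hcx : ∀ n, ball (c n) (σ * ρ n) ⊆ ball x (2 * σ * r) := fun n => by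
      rcases n with _ | n
      · rw [hc0]; refine ball_subset_ball (le_of_eq ?_); simp only [ρ]; ring
      · rw [hcs]
        refine ball_subset_ball' ?_
        nlinarith [hρle n]
    set a : ℕ → ℝ := fun n => ⨍ z in ball (c n) (ρ n), u z ∂μ
    have hstep : ∀ n, edist (a n) (a (n + 1)) ≤ D * A * ENNReal.ofReal (2 * r) ^ β * I * q ^ n := by
      intro n
      have hsub : ball (c (n + 1)) (ρ (n + 1)) ⊆ ball (c n) (ρ n) := by
        rw [hcs]; refine ball_subset_ball' ?_
        linarith [hcd n, hρs n]
      have hdoub : μ (ball (c n) (ρ n)) ≤ D * μ (ball (c (n + 1)) (ρ (n + 1))) := by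
        rw [hcs]
        refine le_trans (measure_mono (ball_subset_ball' ?_))
          (Hd y hyK (ρ (n + 1)) (hρ _) (by linarith [hρR n, hρ (n + 1)]))
        rw [dist_comm]
        linarith [hcd n, hρs n]
      have h1 := edist_setAverage_le hsub (measure_ball_pos μ _ (hρ _)).ne'
        measure_ball_lt_top.ne hdoub (hint _ _)
      have h2 := HP u g hu hug (c n) (hcK n) (ρ n) (hρ n)
        (by linarith [hρR n, hρ (n + 1), hρs n]) _ (hcx n)
      have h3 : ENNReal.ofReal (ρ n) ^ β = ENNReal.ofReal (2 * r) ^ β * q ^ n := by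
        simp only [ρ, q]
        rw [ENNReal.ofReal_mul (by positivity), ENNReal.mul_rpow_of_nonneg _ _ hβ.le,
          ENNReal.ofReal_pow (by norm_num), ← ENNReal.rpow_natCast, ← ENNReal.rpow_natCast,
          ← ENNReal.rpow_mul, ← ENNReal.rpow_mul, mul_comm β]
      calc _ ≤ _ := h1
        _ ≤ D * (A * ENNReal.ofReal (ρ n) ^ β * I) := by gcongr
        _ = _ := by rw [h3]; ring
    have hlim : Tendsto a atTop (𝓝 (u y)) := by
      -- The initial ball has centre x, so it is dropped before shrinking to y.
      rw [← tendsto_add_atTop_iff_nat 1]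
      refine tendsto_setAverage_ball hu y (ρ := fun n => ρ (n + 1)) (fun n => hρ _) ?_
      have : Tendsto ρ atTop (𝓝 (2 * r * 0)) :=
        (tendsto_pow_atTop_nhds_zero_of_lt_one (by norm_num) (by norm_num)).const_mul _
      rw [mul_zero] at this
      exact (tendsto_add_atTop_iff_nat 1).2 this
    have h0 : a 0 = ⨍ z in ball x (2 * r), u z ∂μ := by simp [a, c, ρ]
    rw [← h0]
    exact edist_le_of_edist_le_geometric_of_tendsto₀ q _ hstep hlim
  have hosc : ∀ y ∈ ball x r, edist (f y) (f x) ≤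
      2 * (D * A * ENNReal.ofReal (2 * r) ^ β * I / (1 - q)) := by
    intro y hy
    have h1 : edist (f y) (f x) = edist (u y) (u x) := by
      simp [u, edist_dist]
    rw [h1, two_mul]
    exact (edist_triangle_left _ _ _).trans (add_le_add (main y hy) (main x (mem_ball_self hr)))
  have h2r : ENNReal.ofReal (2 * r) ^ β = ENNReal.ofReal 2 ^ β * ENNReal.ofReal r ^ β := by
    rw [ENNReal.ofReal_mul (by norm_num), ENNReal.mul_rpow_of_nonneg _ _ hβ.le]
  refine ediam_le ?_
  rintro _ ⟨y, hy, rfl⟩ _ ⟨z, hz, rfl⟩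
  calc edist (f y) (f z) ≤ edist (f y) (f x) + edist (f z) (f x) := edist_triangle_right _ _ _
    _ ≤ _ := add_le_add (hosc y hy) (hosc z hz)
    _ = _ := by rw [h2r, div_eq_mul_inv, div_eq_mul_inv]; ring

end

/-! ### Summation and covering tools. -/

/-- Hölder's inequality for series of weighted geometric means. -/
lemma tsum_rpow_mul_rpow_le {ι : Type*} (a b : ι → ℝ≥0∞) {θ : ℝ} (h0 : 0 < θ) (h1 : θ < 1) :
    ∑' i, a i ^ (1 - θ) * b i ^ θ ≤ (∑' i, a i) ^ (1 - θ) * (∑' i, b i) ^ θ := by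
  have h1' : 0 < 1 - θ := by linarith
  refine ENNReal.summable.tsum_le_of_sum_le fun s => ?_
  have hpq : (1 / (1 - θ)).HolderConjugate (1 / θ) := by
    rw [Real.holderConjugate_iff]
    refine ⟨by rw [lt_div_iff₀ h1']; linarith, by simp⟩
  refine (ENNReal.inner_le_Lp_mul_Lq s _ _ hpq).trans ?_
  simp only [← ENNReal.rpow_mul, mul_one_div_cancel h1'.ne', mul_one_div_cancel h0.ne',
    ENNReal.rpow_one, one_div_one_div]
  gcongr <;> exact ENNReal.sum_le_tsum _

/-- A `1`-Lipschitz function comparable to the minimum of `ε` and the distance to the complement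
of an open set. -/
lemma exists_lipschitz_radius {U : Set X} (hU : IsOpen U) {ε : ℝ} (hε : 0 < ε) :
    ∃ h : X → ℝ, (∀ x, h x ≤ ε) ∧ (∀ x ∈ U, 0 < h x) ∧ (∀ x, ball x (h x) ⊆ U) ∧
      ∀ x y, h x ≤ h y + dist x y := by
  -- The cap by ε also covers the case of empty `Uᶜ`, where the distance is ∞.
  have hfin : ∀ x, min (ENNReal.ofReal ε) (infEDist x Uᶜ) ≠ ∞ := fun x =>
    ((min_le_left _ _).trans_lt ENNReal.ofReal_lt_top).ne
  refine ⟨fun x => (min (ENNReal.ofReal ε) (infEDist x Uᶜ)).toReal, fun x => ?_, fun x hx => ?_,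
    fun x y hy => ?_, fun x y => ?_⟩
  · exact ENNReal.toReal_le_of_le_ofReal hε.le (min_le_left _ _)
  · refine ENNReal.toReal_pos (lt_min (by simpa) ?_).ne' (hfin x)
    rw [infEDist_pos_iff_notMem_closure, hU.isClosed_compl.closure_eq]
    simpa
  · by_contra hyU
    rw [mem_ball, dist_edist] at hy
    have h1 := (ENNReal.toReal_lt_toReal (edist_ne_top _ _) (hfin x)).1 hy
    have h2 : infEDist x Uᶜ ≤ edist x y := infEDist_le_edist_of_mem hyU
    rw [edist_comm] at h2
    exact absurd (h1.trans_le (min_le_right _ _)) h2.not_gt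
  · rw [dist_edist, ← ENNReal.toReal_add (hfin y) (edist_ne_top _ _)]
    refine ENNReal.toReal_mono (ENNReal.add_ne_top.2 ⟨hfin y, edist_ne_top _ _⟩) ?_
    rw [← min_add_add_right]
    exact min_le_min le_self_add infEDist_le_infEDist_add_edist

/-- A Whitney-type covering: disjoint small balls whose enlargements cover, with comparable radii
for balls whose large dilations meet. -/
lemma exists_whitney_covering [ProperSpace X] {U : Set X} (hU : IsOpen U) {ε l : ℝ} (hε : 0 < ε)
    (hl : 1 ≤ l) {S : Set X} (hS : S ⊆ U) :
    ∃ (T : Set X) (r : X → ℝ), T ⊆ S ∧ T.Countable ∧ (∀ x ∈ T, 0 < r x) ∧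
      (∀ x, 2 * l * r x ≤ ε) ∧ (T.PairwiseDisjoint fun x => closedBall x (r x)) ∧
      S ⊆ ⋃ x ∈ T, ball x (6 * r x) ∧ (∀ x ∈ T, ball x (l * r x) ⊆ U) ∧
      ∀ x ∈ T, ∀ z ∈ ball x (l * r x), r x ≤ 2 * r z ∧ 2 * r z ≤ 3 * r x := by
  obtain ⟨h, hle, hpos, hball, hlip⟩ := exists_lipschitz_radius hU hε
  have hl0 : 0 < 2 * l := by linarith
  -- Then l r(x) = h(x)/2, so on B(x, l r(x)) the 1-Lipschitz function h stays between h(x)/2 and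
  -- 3h(x)/2.
  set r : X → ℝ := fun x => h x / (2 * l)
  have hr : ∀ x, 2 * l * r x = h x := fun x => mul_div_cancel₀ _ hl0.ne'
  have hrpos : ∀ x ∈ S, 0 < r x := fun x hx => div_pos (hpos x (hS hx)) hl0
  obtain ⟨T, hTS, hdisj, hcov⟩ := Vitali.exists_disjoint_subfamily_covering_enlargement_closedBall
    S (fun x => x) r (ε / (2 * l)) (fun x _ => div_le_div_of_nonneg_right (hle x) hl0.le) 5
    (by norm_num)
  refine ⟨T, r, hTS, ?_, fun x hx => hrpos x (hTS hx), fun x => (hr x).le.trans (hle x), hdisj,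
    fun x hx => ?_, fun x hx => ?_, fun x hx z hz => ?_⟩
  · exact hdisj.countable_of_nonempty_interior fun x hx =>
      ⟨x, ball_subset_interior_closedBall (mem_ball_self (hrpos x (hTS hx)))⟩
  -- The Vitali factor 5 for closed balls becomes 6 for open ones.
  · obtain ⟨b, hb, hsub⟩ := hcov x hx
    refine mem_iUnion₂.2 ⟨b, hb, ?_⟩
    have := hsub (mem_closedBall_self (hrpos x hx).le)
    rw [mem_closedBall] at this
    rw [mem_ball]
    linarith [hrpos b (hTS hb)]
  · refine (ball_subset_ball ?_).trans (hball x)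
    nlinarith [hr x, hrpos x (hTS hx)]
  · rw [mem_ball] at hz
    have h1 := hlip x z
    have h2 := hlip z x
    rw [dist_comm] at h1
    rw [← hr x, ← hr z] at h1 h2
    constructor
    · refine le_of_mul_le_mul_left (a := l) ?_ (by linarith)
      linarith
    · refine le_of_mul_le_mul_left (a := l) ?_ (by linarith)
      linarith

/-- Sums of masses of sets with overlap at most `N`. -/
lemma tsum_measure_le_of_overlap {Ω ι : Type*} [MeasurableSpace Ω] [Countable ι] (ν : Measure Ω)
    {B : ι → Set Ω} (hB : ∀ i, MeasurableSet (B i)) {U : Set Ω} (hBU : ∀ i, B i ⊆ U)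
    (N : ℝ≥0∞) (hN : ∀ z, ∀ F : Finset ι, (∀ i ∈ F, z ∈ B i) → (F.card : ℝ≥0∞) ≤ N) :
    ∑' i, ν (B i) ≤ N * ν U := by
  classical
  have h1 : ∀ i, ν (B i) = ∫⁻ z in toMeasurable ν U, (B i).indicator 1 z ∂ν := fun i => by
    rw [lintegral_indicator_one (hB i), Measure.restrict_apply (hB i),
      inter_eq_left.2 ((hBU i).trans (subset_toMeasurable ν U))]
  simp_rw [h1]
  rw [← lintegral_tsum fun i => (measurable_one.indicator (hB i)).aemeasurable]
  calc _ ≤ ∫⁻ _ in toMeasurable ν U, N ∂ν := by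
        refine lintegral_mono fun z => ENNReal.summable.tsum_le_of_sum_le fun F => ?_
        have := hN z (F.filter fun i => z ∈ B i) (by simp)
        refine le_trans (le_of_eq ?_) this
        simp [indicator_apply]
    _ = _ := by rw [setLIntegral_const, measure_toMeasurable]

/-- Balls centred in an Ahlfors regular set whose dilations contain a common point, which are
disjoint and have comparable radii, are boundedly many. -/
lemma card_le_of_regular [MeasurableSpace X] [BorelSpace X] {H : Measure X} {E : Set X}
    {t ρ : ℝ} (ht : 0 < t) {C : ℝ≥0∞}
    (hreg : ∀ x ∈ E, ∀ r : ℝ, 0 < r → r ≤ ρ →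
      ENNReal.ofReal r ^ t ≤ C * H (ball x r ∩ E) ∧ H (ball x r ∩ E) ≤ C * ENNReal.ofReal r ^ t)
    {l s : ℝ} (hl : 1 ≤ l) (hs : (4 * l + 2) * s ≤ ρ) {r : X → ℝ} {F : Finset X}
    (hFE : ∀ x ∈ F, x ∈ E) (hF : (F : Set X).PairwiseDisjoint fun x => closedBall x (r x)) {z : X}
    (hz : ∀ x ∈ F, z ∈ ball x (l * r x)) (hrs : ∀ x ∈ F, 0 < r x ∧ r x ≤ 2 * s ∧ 2 * s ≤ 3 * r x) :
    (F.card : ℝ≥0∞) ≤ C * C * ENNReal.ofReal (3 / 2 * (4 * l + 2)) ^ t := by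
  rcases F.eq_empty_or_nonempty with rfl | ⟨b, hb⟩
  · simp
  have hs0 : 0 < s := by linarith [hrs b hb]
  have h0 : ENNReal.ofReal (2 / 3 * s) ^ t ≠ 0 :=
    (ENNReal.rpow_pos (by simpa using hs0) (by simp)).ne'
  have hT : ENNReal.ofReal (2 / 3 * s) ^ t ≠ ∞ := ENNReal.rpow_ne_top_of_nonneg ht.le (by simp)
  -- Radii are at most 2s, so centres are within 4ls of each other through z. They are at least
  -- 2s/3, so each core carries H^t-mass at least (2s/3)^t / C.
  have hsub : ⋃ x ∈ F, ball x (r x) ⊆ ball b ((4 * l + 2) * s) := by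
    refine iUnion₂_subset fun x hx => ball_subset_ball' ?_
    have h1 := mem_ball.1 (hz x hx)
    have h2 := mem_ball.1 (hz b hb)
    have h3 := dist_triangle_left x b z
    nlinarith [hrs x hx, hrs b hb]
  rw [← ENNReal.mul_le_mul_iff_left h0 hT]
  calc (F.card : ℝ≥0∞) * ENNReal.ofReal (2 / 3 * s) ^ t
      = ∑ x ∈ F, ENNReal.ofReal (2 / 3 * s) ^ t := by simp
    _ ≤ ∑ x ∈ F, C * H.restrict E (ball x (r x)) := by
        refine Finset.sum_le_sum fun x hx => ?_
        obtain ⟨h1, h2, h3⟩ := hrs x hx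
        rw [Measure.restrict_apply measurableSet_ball]
        refine le_trans ?_ (hreg x (hFE x hx) (r x) h1 (by nlinarith)).1
        gcongr
        linarith
    _ = C * H.restrict E (⋃ x ∈ F, ball x (r x)) := by
        rw [← Finset.mul_sum, measure_biUnion_finset
          (hF.mono fun _ => ball_subset_closedBall) fun _ _ => measurableSet_ball]
    _ ≤ C * H.restrict E (ball b ((4 * l + 2) * s)) := by gcongr
    _ ≤ C * (C * ENNReal.ofReal ((4 * l + 2) * s) ^ t) := by
        rw [Measure.restrict_apply measurableSet_ball]
        gcongr
        exact (hreg b (hFE b hb) _ (by positivity) hs).2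
    _ = _ := by
        rw [show (4 * l + 2) * s = 3 / 2 * (4 * l + 2) * (2 / 3 * s) by ring,
          ENNReal.ofReal_mul (by positivity), ENNReal.mul_rpow_of_nonneg _ _ ht.le]
        ring

/-! ### Image coverings and vanishing Hausdorff measure. -/

/-- Efficient coverings of the image of an Ahlfors regular set under a map satisfying a Morrey
estimate. -/
lemma exists_image_covering [ProperSpace X] [MeasurableSpace X] [BorelSpace X] {H ν : Measure X}
    {E : Set X} {Q p t ρ R : ℝ} (hQ : 0 < Q) (hp : Q < p) (ht : 0 < t) (hρ : 0 < ρ) (hR : 0 < R)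
    {C A : ℝ≥0∞} (hC : C ≠ ∞) (hA : A ≠ ∞)
    (hreg : ∀ x ∈ E, ∀ r : ℝ, 0 < r → r ≤ ρ →
      ENNReal.ofReal r ^ t ≤ C * H (ball x r ∩ E) ∧ H (ball x r ∩ E) ≤ C * ENNReal.ofReal r ^ t)
    {f : X → Y} {l : ℝ} (hl : 1 ≤ l) {x₀ : X} (hx₀ : x₀ ∈ E)
    (hmor : ∀ x ∈ ball x₀ ρ, ∀ r : ℝ, 0 < r → r < R → ediam (f '' ball x r) ≤
      A * ENNReal.ofReal r ^ (1 - Q / p) * ν (ball x (l * r)) ^ (1 / p)) :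
    ∃ B : ℝ≥0∞, B ≠ ∞ ∧ ∀ U : Set X, IsOpen U → U ⊆ ball x₀ ρ →
      ∃ (T : Set X) (r : X → ℝ), T.Countable ∧ E ∩ U ⊆ ⋃ x ∈ T, ball x (r x) ∧
        (∀ x ∈ T, ediam (f '' ball x (r x)) ≤ B * ν U ^ (1 / p)) ∧
        ∑' x : T, ediam (f '' ball (x : X) (r x)) ^ (p * t / (p - Q + t)) ≤
          B * ν U ^ (t / (p - Q + t)) := by
  have hp0 : 0 < p := hQ.trans hp
  have hd : 0 < p - Q + t := by linarith
  set α := p * t / (p - Q + t) with hα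
  set θ := t / (p - Q + t) with hθ
  set β := 1 - Q / p with hβ
  have hα0 : 0 < α := by positivity
  have hθ0 : 0 < θ := by positivity
  have hθ1 : θ < 1 := by rw [hθ, div_lt_one hd]; linarith
  have hβ0 : 0 < β := by rw [hβ, sub_pos, div_lt_one hp0]; exact hp
  have hαβ : β * α = t * (1 - θ) := by rw [hβ, hα, hθ]; field_simp; ring
  have hαp : 1 / p * α = θ := by rw [hα, hθ]; field_simp
  set N : ℝ≥0∞ := C * C * ENNReal.ofReal (3 / 2 * (4 * (6 * l) + 2)) ^ t
  set W : ℝ≥0∞ := ENNReal.ofReal 6 ^ t * C * (C * ENNReal.ofReal ρ ^ t)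
  have hN : N ≠ ∞ := ENNReal.mul_ne_top (ENNReal.mul_ne_top hC hC)
    (ENNReal.rpow_ne_top_of_nonneg ht.le (by simp))
  have hW : W ≠ ∞ := ENNReal.mul_ne_top (ENNReal.mul_ne_top
    (ENNReal.rpow_ne_top_of_nonneg ht.le (by simp)) hC) (ENNReal.mul_ne_top hC
    (ENNReal.rpow_ne_top_of_nonneg ht.le (by simp)))
  -- The first constant controls individual diameters, which must tend to 0 for Hausdorff measure;
  -- the second controls the sum.
  refine ⟨max (A * ENNReal.ofReal R ^ β) (A ^ α * (W ^ (1 - θ) * N ^ θ)), ?_, fun U hU hUρ => ?_⟩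
  · refine (max_lt (ENNReal.mul_lt_top hA.lt_top ?_) (ENNReal.mul_lt_top ?_
      (ENNReal.mul_lt_top ?_ ?_))).ne
    · exact ENNReal.rpow_lt_top_of_nonneg hβ0.le (by simp)
    · exact ENNReal.rpow_lt_top_of_nonneg hα0.le hA
    · exact ENNReal.rpow_lt_top_of_nonneg (by linarith) hW
    · exact ENNReal.rpow_lt_top_of_nonneg hθ0.le hN
  -- The dilation is 6l because Morrey's factor l acts on the covering balls of radius 6r. The bound
  -- R makes these admissible for Morrey; ρ/3 keeps the counting ball in `card_le_of_regular` within
  -- the scale ρ of regularity.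
  obtain ⟨T, r, hTS, hTc, hr0, hrε, hdisj, hcov, hTU, hcomp⟩ := exists_whitney_covering hU
    (ε := min (ρ / 3) R) (l := 6 * l) (by positivity) (by linarith)
    (inter_subset_right : E ∩ U ⊆ U)
  have hrρ : ∀ x, 2 * (6 * l) * r x ≤ ρ / 3 := fun x => (hrε x).trans (min_le_left _ _)
  have hrR : ∀ x ∈ T, 6 * r x < R := fun x hx => by
    have := (hrε x).trans (min_le_right _ _)
    nlinarith [hr0 x hx]
  have hballU : ∀ x ∈ T, ball x (r x) ⊆ U := fun x hx =>
    (ball_subset_ball (by nlinarith [hr0 x hx])).trans (hTU x hx)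
  have hTc' : Countable T := hTc.to_subtype
  have hm : ∀ x ∈ T, ediam (f '' ball x (6 * r x)) ≤
      A * ENNReal.ofReal (6 * r x) ^ β * ν (ball x (6 * l * r x)) ^ (1 / p) := fun x hx => by
    have := hmor x (hUρ (hTS hx).2) (6 * r x) (by linarith [hr0 x hx]) (hrR x hx)
    rwa [show l * (6 * r x) = 6 * l * r x by ring] at this
  refine ⟨T, fun x => 6 * r x, hTc, hcov, fun x hx => ?_, ?_⟩
  · calc _ ≤ _ := hm x hx
      _ ≤ A * ENNReal.ofReal R ^ β * ν U ^ (1 / p) := by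
        gcongr
        exacts [(hrR x hx).le, hTU x hx]
      _ ≤ _ := by gcongr; exact le_max_left _ _
  have hoverlap : ∑' x : T, ν (ball (x : X) (6 * l * r x)) ≤ N * ν U := by
    refine tsum_measure_le_of_overlap (ι := T) ν
      (B := fun x => ball (x : X) (6 * l * r x)) (fun x => measurableSet_ball)
      (fun x => hTU x x.2) N fun z F hF => ?_
    rcases F.eq_empty_or_nonempty with rfl | ⟨b, hb⟩
    · simp
    have hrz : 0 < r z := by
      have := hcomp b b.2 z (hF b hb)
      linarith [hr0 b b.2]
    have hmem : ∀ x ∈ F.map (Function.Embedding.subtype _), ∃ h : x ∈ T, (⟨x, h⟩ : T) ∈ F := by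
      simp
    rw [← Finset.card_map (Function.Embedding.subtype _)]
    refine card_le_of_regular (s := r z) (r := r) (z := z) ht hreg (by linarith)
      (by nlinarith [hrρ z]) (fun x hx => (hTS (hmem x hx).1).1)
      (hdisj.subset fun x hx => (hmem x hx).1) (fun x hx => ?_) fun x hx => ?_
    · obtain ⟨h, h'⟩ := hmem x hx
      exact hF _ h'
    · obtain ⟨h, h'⟩ := hmem x hx
      exact ⟨hr0 x h, hcomp x h z (hF _ h')⟩
  have hradii : ∑' x : T, ENNReal.ofReal (6 * r x) ^ t ≤ W := by
    calc _ ≤ ∑' x : T, ENNReal.ofReal 6 ^ t * C * H.restrict E (ball (x : X) (r x)) := by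
          refine ENNReal.tsum_le_tsum fun x => ?_
          rw [ENNReal.ofReal_mul (by norm_num), ENNReal.mul_rpow_of_nonneg _ _ ht.le, mul_assoc,
            Measure.restrict_apply measurableSet_ball]
          gcongr
          exact (hreg x (hTS x.2).1 _ (hr0 x x.2) (by nlinarith [hrρ x, hr0 x x.2])).1
      _ = ENNReal.ofReal 6 ^ t * C * H.restrict E (⋃ x : T, ball (x : X) (r x)) := by
          rw [ENNReal.tsum_mul_left, measure_iUnion _ fun _ => measurableSet_ball]
          intro x y hxy
          exact (hdisj x.2 y.2 fun h => hxy (Subtype.ext h)).mono ball_subset_closedBall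
            ball_subset_closedBall
      _ ≤ ENNReal.ofReal 6 ^ t * C * H.restrict E (ball x₀ ρ) := by
          gcongr
          exact iUnion_subset fun x => (hballU x x.2).trans hUρ
      _ ≤ W := by
          rw [Measure.restrict_apply measurableSet_ball]
          simp only [W]
          gcongr
          exact (hreg x₀ hx₀ ρ hρ le_rfl).2
  calc ∑' x : T, ediam (f '' ball (x : X) (6 * r x)) ^ α
      ≤ ∑' x : T, A ^ α * ((ENNReal.ofReal (6 * r x) ^ t) ^ (1 - θ) *
          ν (ball (x : X) (6 * l * r x)) ^ θ) := by
        refine ENNReal.tsum_le_tsum fun x => ?_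
        refine (ENNReal.rpow_le_rpow (hm x x.2) hα0.le).trans (le_of_eq ?_)
        rw [ENNReal.mul_rpow_of_nonneg _ _ hα0.le, ENNReal.mul_rpow_of_nonneg _ _ hα0.le,
          ← ENNReal.rpow_mul, ← ENNReal.rpow_mul, ← ENNReal.rpow_mul, hαβ, hαp, mul_assoc]
    _ ≤ A ^ α * (W ^ (1 - θ) * (N * ν U) ^ θ) := by
        rw [ENNReal.tsum_mul_left]
        gcongr
        refine (tsum_rpow_mul_rpow_le _ _ hθ0 hθ1).trans ?_
        gcongr
    _ = A ^ α * (W ^ (1 - θ) * N ^ θ) * ν U ^ θ := by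
        rw [ENNReal.mul_rpow_of_nonneg _ _ hθ0.le]; ring
    _ ≤ _ := by gcongr; exact le_max_right _ _

/-- The image of a piece of a null Ahlfors regular set is negligible, given a Morrey estimate. -/
lemma hausdorffMeasure_image_eq_zero_of_morrey [ProperSpace X] [MeasurableSpace X] [BorelSpace X]
    [MeasurableSpace Y] [BorelSpace Y] {H ν : Measure X}
    {E : Set X} {Q p t ρ R : ℝ} (hQ : 0 < Q) (hp : Q < p) (ht : 0 < t) (hρ : 0 < ρ) (hR : 0 < R)
    {C A : ℝ≥0∞} (hC : C ≠ ∞) (hA : A ≠ ∞)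
    (hreg : ∀ x ∈ E, ∀ r : ℝ, 0 < r → r ≤ ρ →
      ENNReal.ofReal r ^ t ≤ C * H (ball x r ∩ E) ∧ H (ball x r ∩ E) ≤ C * ENNReal.ofReal r ^ t)
    {f : X → Y} {l : ℝ} (hl : 1 ≤ l) {x₀ : X} (hx₀ : x₀ ∈ E)
    (hmor : ∀ x ∈ ball x₀ ρ, ∀ r : ℝ, 0 < r → r < R → ediam (f '' ball x r) ≤
      A * ENNReal.ofReal r ^ (1 - Q / p) * ν (ball x (l * r)) ^ (1 / p))
    (hν : ν (ball x₀ ρ) < ∞) (hE : ν E = 0) :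
    Measure.hausdorffMeasure (p * t / (p - Q + t)) (f '' (E ∩ ball x₀ ρ)) = 0 := by
  obtain ⟨B, hB, H⟩ := exists_image_covering hQ hp ht hρ hR hC hA hreg hl hx₀ hmor
  have hp0 : 0 < p := hQ.trans hp
  have hd : 0 < p - Q + t := by linarith
  have hfin : IsFiniteMeasure (ν.restrict (ball x₀ ρ)) := ⟨by simpa using hν⟩
  have hU : ∀ n : ℕ, ∃ U : Set X, IsOpen U ∧ U ⊆ ball x₀ ρ ∧ E ∩ ball x₀ ρ ⊆ E ∩ U ∧
      ν U ≤ (n : ℝ≥0∞)⁻¹ := fun n => by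
    -- Outer regularity is applied to the restriction, a finite measure.
    obtain ⟨V, hEV, hV, hνV⟩ := Set.exists_isOpen_lt_of_lt (μ := ν.restrict (ball x₀ ρ)) E
      (n : ℝ≥0∞)⁻¹ (by
        refine (le_antisymm ((Measure.restrict_apply_le _ _).trans hE.le) zero_le).trans_lt ?_
        simp)
    refine ⟨V ∩ ball x₀ ρ, hV.inter isOpen_ball, inter_subset_right,
      fun x hx => ⟨hx.1, hEV hx.1, hx.2⟩, ?_⟩
    rw [Measure.restrict_apply hV.measurableSet] at hνV
    exact hνV.le
  choose U hUo hUρ hEU hνU using hU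
  choose T r hTc hcov hdiam hsum using fun n => H (U n) (hUo n) (hUρ n)
  have hlim : ∀ s : ℝ, 0 < s →
      Tendsto (fun n : ℕ => B * ((n : ℝ≥0∞)⁻¹) ^ s) atTop (𝓝 0) := fun s hs => by
    have h1 := (ENNReal.continuous_rpow_const (y := s)).tendsto 0 |>.comp
      ENNReal.tendsto_inv_nat_nhds_zero
    rw [ENNReal.zero_rpow_of_pos hs] at h1
    simpa using ENNReal.Tendsto.const_mul h1 (.inr hB)
  have hTc' : ∀ n, Countable (T n) := fun n => (hTc n).to_subtype
  have key := Measure.hausdorffMeasure_le_liminf_tsum (ι := fun n => T n) (p * t / (p - Q + t))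
    (f '' (E ∩ ball x₀ ρ)) (l := atTop) (fun n : ℕ => B * ((n : ℝ≥0∞)⁻¹) ^ (1 / p))
    (hlim _ (by positivity)) (fun n x => f '' ball (x : X) (r n x))
    (Eventually.of_forall fun n x => (hdiam n x x.2).trans (by gcongr; exact hνU n))
    (Eventually.of_forall fun n => by
      rw [← image_iUnion]
      refine image_mono ((hEU n).trans ((hcov n).trans ?_))
      rw [biUnion_eq_iUnion])
  refine le_antisymm (key.trans ?_) zero_le
  rw [← (hlim (t / (p - Q + t)) (by positivity)).liminf_eq]
  refine liminf_le_liminf (Eventually.of_forall fun n => (hsum n).trans ?_)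
  gcongr
  exact hνU n

/-- An Ahlfors regular set with more than one point satisfies uniform two-sided bounds at some
scale. -/
lemma IsAhlforsRegularSet.exists_bounds [MeasurableSpace X] [BorelSpace X] {t : ℝ} {E : Set X}
    (h : IsAhlforsRegularSet t E) (hE : E.Nontrivial) :
    ∃ ρ : ℝ, 0 < ρ ∧ ∃ C : ℝ≥0∞, C ≠ ∞ ∧ ∀ x ∈ E, ∀ r : ℝ, 0 < r → r ≤ ρ →
      ENNReal.ofReal r ^ t ≤ C * Measure.hausdorffMeasure t (ball x r ∩ E) ∧
        Measure.hausdorffMeasure t (ball x r ∩ E) ≤ C * ENNReal.ofReal r ^ t := by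
  obtain ⟨C, hC, H⟩ := h
  have hpos : 0 < ediam E := ediam_pos_iff.2 hE
  obtain ⟨ρ, hρ0, hρ⟩ := ENNReal.lt_iff_exists_nnreal_btwn.1 hpos
  refine ⟨ρ, by exact_mod_cast hρ0, C, ENNReal.coe_ne_top, fun x hx r hr hrρ => ?_⟩
  have hr' : ENNReal.ofReal r ≤ 2 * ediam E := by
    calc ENNReal.ofReal r ≤ ENNReal.ofReal ρ := ENNReal.ofReal_le_ofReal hrρ
      _ = ρ := ENNReal.ofReal_coe_nnreal
      _ ≤ ediam E := hρ.le
      _ ≤ 2 * ediam E := le_mul_of_one_le_left zero_le one_le_two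
  obtain ⟨h1, h2⟩ := H x hx r hr hr'
  rw [← ENNReal.ofReal_rpow_of_pos hr] at h1 h2
  have hC0 : (C : ℝ≥0∞) ≠ 0 := by exact_mod_cast (zero_lt_one.trans_le hC).ne'
  exact ⟨by rwa [ENNReal.div_le_iff hC0 ENNReal.coe_ne_top, mul_comm] at h1, h2⟩

end SobolevDistortion

/-! ### Globalization. -/

theorem theorem4 {X Y : Type*}
    [MetricSpace X] [ProperSpace X] [MeasurableSpace X] [BorelSpace X]
    [MetricSpace Y] [MeasurableSpace Y] [BorelSpace Y]
    (μ : Measure X) [IsLocallyFiniteMeasure μ] [μ.IsOpenPosMeasure]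
    (Q p t : ℝ) (hQ : 1 ≤ Q) (hp : Q < p) (ht : 0 < t) (htQ : t < Q)
    (hhom : SobolevDistortion.IsLocallyHomogeneous μ Q)
    (hpoin : SobolevDistortion.SupportsLocalPoincare μ Q)
    (f : X → Y) (hf : Continuous f)
    (hgrad : ∃ g : X → ℝ≥0∞,
      SobolevDistortion.IsUpperGradient f g ∧ SobolevDistortion.LpLoc μ p g)
    (E : Set X) (hE : μ E = 0) (hreg : SobolevDistortion.IsAhlforsRegularSet t E) :
    Measure.hausdorffMeasure (p * t / (p - Q + t)) (f '' E) = 0 := by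
  have hQ0 : 0 < Q := by linarith
  have hp0 : 0 < p := hQ0.trans hp
  have hd : 0 < p - Q + t := by linarith
  have hα : 0 < p * t / (p - Q + t) := by positivity
  rcases E.subsingleton_or_nontrivial with hsub | hnt
  -- For at most one point the regularity condition is void (the diameter is 0), but points are null
  -- since the exponent is positive.
  · have := Measure.nullSingletonClass_hausdorff Y hα
    exact (hsub.image f).measure_zero _
  obtain ⟨g, hg, hgp⟩ := hgrad
  obtain ⟨ρ, hρ0, C, hC, hbd⟩ := hreg.exists_bounds hnt
  have hgm : Measurable fun x => g x ^ p := hg.1.pow_const p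
  have hloc : ∀ x ∈ E,
      Measure.hausdorffMeasure (p * t / (p - Q + t)) (f '' (E ∩ Metric.ball x ρ)) = 0 := by
    intro x hx
    obtain ⟨R, hR, A, hA, l, hl, hmor⟩ :=
      SobolevDistortion.exists_morrey_estimate hQ0 hp hhom hpoin (isCompact_closedBall x ρ) hf hg
    refine SobolevDistortion.hausdorffMeasure_image_eq_zero_of_morrey
      (ν := μ.withDensity fun x => g x ^ p) hQ0 hp ht hρ0 hR hC hA hbd hl hx (fun y hy r hr hrR => ?_) ?_
      (withDensity_absolutelyContinuous _ _ hE)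
    · rw [withDensity_apply _ measurableSet_ball]
      exact hmor y (Metric.ball_subset_closedBall hy) r hr hrR
    · rw [withDensity_apply _ measurableSet_ball]
      exact (lintegral_mono_set Metric.ball_subset_closedBall).trans_lt
        (hgp _ (isCompact_closedBall x ρ))
  -- Proper spaces are second countable, so countably many of the local pieces exhaust E.
  obtain ⟨S, hSE, hSc, hS⟩ := TopologicalSpace.countable_cover_nhdsWithin (s := E)
    (f := fun x => Metric.ball x ρ) fun x _ =>
      mem_nhdsWithin_of_mem_nhds (Metric.ball_mem_nhds x hρ0)
  refine measure_mono_null (t := ⋃ x ∈ S, f '' (E ∩ Metric.ball x ρ)) ?_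
    ((measure_biUnion_null_iff hSc).2 fun x hx => hloc x (hSE hx))
  rintro _ ⟨y, hy, rfl⟩
  obtain ⟨x, hx, hyx⟩ := mem_iUnion₂.1 (hS hy)
  exact mem_iUnion₂.2 ⟨x, hx, y, ⟨hy, hyx⟩, rfl⟩
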